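/- For each $n\ge 1$ let $m(n)\in\mathbb N$, where $m(n)=O(n^{\alpha})$ for some real $\alpha$ (for instance $m(n)=\lfloor n^\alpha\rfloor$, $\alpha>1$), and let $\mathcal F_n$ be a collection of probability distributions of $Z=(Y,X_1,\dots,X_{m(n)})\in\mathbb R\times\mathbb R^{m(n)}$. Assume that there is a constant $M$ such that for all $n$ and all $F\in\mathcal F_n$ one has $|X_j|\le M$ for every $j\le m(n)$, $F$-almost surely. Let $l\ge 0$ be a prediction loss and consider the predictors $g_\beta(X)=\rho\big(\sum_j\beta_jX_j\big)$, $\beta\in\mathbb R^{m(n)}$, where $\rho:\mathbb R\to\mathbb R$. Assume (Condition 2) that $h(y,t)=l(y,\rho(t))$ is bounded on $\mathbb R\times\mathbb R$ and uniformly continuous in $t\in\mathbb R$, uniformly in $y$ (and measurable in $y$). Put $L_F(\beta)=E_F\,l(Y,g_\beta(X))$ and, for a sample $Z^1,\dots,Z^n$, $L_{\hat F_n}(\beta)=\frac1n\sum_{i=1}^n l(Y^i,g_\beta(X^i))$. Let $b_n\ge 0$ satisfy $b_n=o\big(\sqrt{n/\log n}\big)$, and let $B^n=\{\beta\in\mathbb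 R^{m(n)}:\|\beta\|_1\le b_n\}$. Then the $\ell_1$-constrained empirical risk minimiser $$\tilde\beta_n\in\arg\min_{\|\beta\|_1\le b_n}L_{\hat F_n}(\beta)$$ exists for every sample, and every choice of it is persistent with respect to $B^n$: a best predictor $\beta^*_F\in\arg\min_{\beta\in B^n}L_F(\beta)$ exists for all $n$ and $F\in\mathcal F_n$, and for every $\varepsilon>0$ $$\sup_{F\in\mathcal F_n}P_F\big(L_F(\tilde\beta_n)-L_F(\beta^*_F)>\varepsilon\big)\longrightarrow 0\qquad(n\to\infty),$$ where under $P_F$ the observations $Z^1,\dots,Z^n$ are independent with distribution $F$. No sparsity of $\beta_F^*$ is assumed. -/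

import Mathlib

open MeasureTheory Filter Topology Asymptotics

namespace Persistence

/-- An observation `Z = (Y, X₁, …, X_d)`: the outcome and the explanatory variables. -/
abbrev Obs (d : ℕ) : Type := ℝ × (Fin d → ℝ)

/-- The risk `L_F(β) = E_F l(Y, g_β(X))`. -/
noncomputable def risk {d : ℕ} (l : ℝ → ℝ → ℝ) (g : (Fin d → ℝ) → (Fin d → ℝ) → ℝ)
    (F : ProbabilityMeasure (Obs d)) (β : Fin d → ℝ) : ℝ :=
  ∫ z, l z.1 (g β z.2) ∂(F : Measure (Obs d))

/-- The empirical risk `n⁻¹ ∑ᵢ l(Yⁱ, g_β(Xⁱ))` of a sample of size `n`. -/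
noncomputable def empiricalRisk {n d : ℕ} (l : ℝ → ℝ → ℝ)
    (g : (Fin d → ℝ) → (Fin d → ℝ) → ℝ) (z : Fin n → Obs d) (β : Fin d → ℝ) : ℝ :=
  (1 / (n : ℝ)) * ∑ i, l (z i).1 (g β (z i).2)

/-- `β` is a minimiser of `f` over `B` (an `arg min`, not necessarily the only one). -/
def IsArgMin {d : ℕ} (f : (Fin d → ℝ) → ℝ) (B : Set (Fin d → ℝ)) (β : Fin d → ℝ) : Prop :=
  β ∈ B ∧ ∀ β' ∈ B, f β ≤ f β'

/-- The closed `ℓ₁` ball of radius `r` centred at the origin of `ℝᵈ`. -/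
def l1Ball (d : ℕ) (r : ℝ) : Set (Fin d → ℝ) := {β | ∑ j, |β j| ≤ r}

/-- The predictors `g_β(X₁, …, X_d) = ρ(∑ⱼ βⱼ Xⱼ)`. -/
def linkPredictor (ρ : ℝ → ℝ) {d : ℕ} (β x : Fin d → ℝ) : ℝ := ρ (∑ j, β j * x j)

/-- The procedures `βhat n` are persistent with respect to the sets `B n`, for the triangular
array given by the classes `𝓕 n` of distributions, the predictors `g n` and the loss `l`:
best predictors `βstar n F` in `B n` exist, and the excess risk over them tends to `0` in
probability, uniformly over `F ∈ 𝓕 n`, for a sample of `n` independent observations from `F`.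
(The value of the risk at `βstar n F` does not depend on which minimiser is taken.) -/
def IsPersistent (m : ℕ → ℕ) (𝓕 : ∀ n, Set (ProbabilityMeasure (Obs (m n))))
    (B : ∀ n, Set (Fin (m n) → ℝ)) (l : ℝ → ℝ → ℝ)
    (g : ∀ n, (Fin (m n) → ℝ) → (Fin (m n) → ℝ) → ℝ)
    (βhat : ∀ n, (Fin n → Obs (m n)) → (Fin (m n) → ℝ)) : Prop :=
  ∃ βstar : ∀ n, ProbabilityMeasure (Obs (m n)) → (Fin (m n) → ℝ),
    (∀ n, ∀ F ∈ 𝓕 n, IsArgMin (risk l (g n) F) (B n) (βstar n F)) ∧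
    ∀ ε : ℝ, 0 < ε →
      Tendsto
        (fun n => ⨆ F ∈ 𝓕 n, Measure.pi (fun _ : Fin n => (F : Measure (Obs (m n))))
          {z | ε < risk l (g n) F (βhat n z) - risk l (g n) F (βstar n F)})
        atTop (𝓝 0)

/-- `h(y, t) = l(y, ρ(t))` is bounded, and uniformly continuous in `t`, uniformly in `y`. -/
def BoundedUniformlyContinuous (l : ℝ → ℝ → ℝ) (ρ : ℝ → ℝ) : Prop :=
  (∃ C : ℝ, ∀ y t, |l y (ρ t)| ≤ C) ∧
    ∀ ε : ℝ, 0 < ε → ∃ δ : ℝ, 0 < δ ∧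
      ∀ y s t, |s - t| < δ → |l y (ρ s) - l y (ρ t)| < ε

/-- The explanatory variables are bounded by one constant under all the distributions. -/
def BoundedCovariates (m : ℕ → ℕ) (𝓕 : ∀ n, Set (ProbabilityMeasure (Obs (m n)))) : Prop :=
  ∃ M : ℝ, ∀ n, ∀ F ∈ 𝓕 n, ∀ᵐ z ∂(F : Measure (Obs (m n))), ∀ j, |z.2 j| ≤ M

end Persistence

/-! A minimiser of the empirical risk has excess risk at most twice the supremum over the `ℓ₁` ball
of |empirical risk − risk|, so a uniform deviation bound suffices. The ball is handled by Maurey's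
method. A point `β` of it is the mean of a random element of the `2m+1` points `0`, `± b eⱼ`, and
the average of `k` independent copies predicts `∑ⱼ βⱼ xⱼ` with mean square error at most `(bM)²/k`,
whatever the dimension (`sum_weight_mul_sq_l1VertexMean_sub_le`). Since the loss is bounded and
uniformly continuous, this controls the mean change of the loss at each bounded observation, hence
of both risks at once (`abs_empiricalRisk_sub_risk_le`).

It remains to control at most `(2m+1)^k` averages, by Hoeffding's inequality and a union bound. For
a fixed accuracy `k` is of order `b² + 1`, so the entropy `k log(2m+1) = O((b² + 1) log n)` is
`o(n)` and loses to the exponent `-cn`. This is where the rate of `b` enters; sparsity plays no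
role. -/

namespace Persistence

/-! ### Second moment of a sum of independent centred variables -/

section Weights

variable {ι : Type*} [Fintype ι]

/-- Variances of independent variables add: on splitting off one coordinate, the cross term carries
the factor `∑ i, w i * a i = 0`. With finite sums no probability space is needed. -/
theorem sum_prod_weight_mul_sum_sq {w a : ι → ℝ} (hw : ∑ i, w i = 1)
    (ha : ∑ i, w i * a i = 0) (k : ℕ) :
    ∑ f : Fin k → ι, (∏ s, w (f s)) * (∑ s, a (f s)) ^ 2 = k * ∑ i, w i * a i ^ 2 := by
  induction k with
  | zero => simp
  | succ k ih =>
    have hprod : ∑ f : Fin k → ι, ∏ s, w (f s) = 1 := by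
      rw [← Fintype.sum_pow, hw, one_pow]
    rw [← (Fin.consEquiv fun _ : Fin (k + 1) => ι).sum_comp, Fintype.sum_prod_type]
    have hexpand : ∀ (i : ι) (f : Fin k → ι),
        (∏ s, w ((Fin.consEquiv fun _ : Fin (k + 1) => ι) (i, f) s)) *
            (∑ s, a ((Fin.consEquiv fun _ : Fin (k + 1) => ι) (i, f) s)) ^ 2
          = w i * a i ^ 2 * ∏ s, w (f s)
            + w i * a i * (2 * ((∏ s, w (f s)) * ∑ s, a (f s)))
            + w i * ((∏ s, w (f s)) * (∑ s, a (f s)) ^ 2) := by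
      intro i f
      simp only [Fin.consEquiv_apply, Fin.prod_univ_succ, Fin.sum_univ_succ, Fin.cons_zero,
        Fin.cons_succ]
      ring
    simp only [hexpand, Finset.sum_add_distrib, ← Finset.mul_sum, ← Finset.sum_mul, hprod, ha, hw,
      ih]
    push_cast
    ring

end Weights

/-! ### Maurey's method on the `ℓ₁` ball -/

section Vertices

variable {d : ℕ}

/-- The origin and the vertices `± r eⱼ` of the `ℓ₁` ball of radius `r`. -/
def l1Vertex (r : ℝ) : Option (Fin d × Bool) → Fin d → ℝ
  | none => 0
  | some (j, true) => Pi.single j r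
  | some (j, false) => Pi.single j (-r)

/-- The barycentric weights of `β` on the points `l1Vertex r`. -/
noncomputable def l1Weight (r : ℝ) (β : Fin d → ℝ) : Option (Fin d × Bool) → ℝ
  | none => 1 - (∑ j, |β j|) / r
  | some (j, true) => (β j)⁺ / r
  | some (j, false) => (β j)⁻ / r

/-- The average of `k` of the points `l1Vertex r`. -/
noncomputable def l1VertexMean (r : ℝ) {k : ℕ} (f : Fin k → Option (Fin d × Bool)) : Fin d → ℝ :=
  fun j => (1 / (k : ℝ)) * ∑ s, l1Vertex r (f s) j

theorem l1Weight_nonneg {r : ℝ} (hr : 0 ≤ r) {β : Fin d → ℝ} (hβ : β ∈ l1Ball d r)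
    (i : Option (Fin d × Bool)) : 0 ≤ l1Weight r β i := by
  match i with
  | none => exact sub_nonneg.2 (div_le_one_of_le₀ hβ hr)
  | some (j, true) => exact div_nonneg (posPart_nonneg _) hr
  | some (j, false) => exact div_nonneg (negPart_nonneg _) hr

theorem sum_l1Weight (r : ℝ) (β : Fin d → ℝ) : ∑ i, l1Weight r β i = 1 := by
  simp only [Fintype.sum_option, Fintype.sum_prod_type, Fintype.sum_bool, l1Weight, ← add_div,
    posPart_add_negPart, ← Finset.sum_div]
  ring

theorem sum_l1Vertex_mul (r : ℝ) (x : Fin d → ℝ) (i : Option (Fin d × Bool)) :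
    ∑ j, l1Vertex r i j * x j =
      match i with
      | none => 0
      | some (j, true) => r * x j
      | some (j, false) => -r * x j := by
  match i with
  | none => simp [l1Vertex]
  | some (j, true) => simp [l1Vertex, Pi.single_apply, ite_mul]
  | some (j, false) => simp [l1Vertex, Pi.single_apply, ite_mul]

theorem abs_sum_l1Vertex_mul_le {r M : ℝ} (hr : 0 ≤ r) (hM : 0 ≤ M) {x : Fin d → ℝ}
    (hx : ∀ j, |x j| ≤ M) (i : Option (Fin d × Bool)) :
    |∑ j, l1Vertex r i j * x j| ≤ r * M := by
  rw [sum_l1Vertex_mul]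
  match i with
  | none => simpa using mul_nonneg hr hM
  | some (j, true) =>
    simpa [abs_mul, abs_of_nonneg hr] using mul_le_mul_of_nonneg_left (hx j) hr
  | some (j, false) =>
    simpa [abs_mul, abs_of_nonneg hr] using mul_le_mul_of_nonneg_left (hx j) hr

theorem eq_zero_of_mem_l1Ball_zero {β : Fin d → ℝ} (hβ : β ∈ l1Ball d 0) : β = 0 := by
  funext j
  have h : |β j| ≤ ∑ j, |β j| :=
    Finset.single_le_sum (f := fun j => |β j|) (fun j _ => abs_nonneg _) (Finset.mem_univ j)
  exact abs_nonpos_iff.1 (h.trans hβ)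

theorem sum_l1Weight_mul {r : ℝ} {β : Fin d → ℝ} (hβ : β ∈ l1Ball d r) (x : Fin d → ℝ) :
    ∑ i, l1Weight r β i * ∑ j, l1Vertex r i j * x j = ∑ j, β j * x j := by
  simp only [sum_l1Vertex_mul, Fintype.sum_option, Fintype.sum_prod_type, Fintype.sum_bool,
    l1Weight, mul_zero, zero_add]
  refine Finset.sum_congr rfl fun j _ => ?_
  rcases eq_or_ne r 0 with rfl | hr
  · simp [eq_zero_of_mem_l1Ball_zero hβ]
  · conv_rhs => rw [← posPart_sub_negPart (β j)]
    field_simp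
    ring

theorem sum_l1VertexMean_mul (r : ℝ) {k : ℕ} (f : Fin k → Option (Fin d × Bool))
    (x : Fin d → ℝ) :
    ∑ j, l1VertexMean r f j * x j = (1 / (k : ℝ)) * ∑ s, ∑ j, l1Vertex r (f s) j * x j := by
  simp only [l1VertexMean, mul_assoc, ← Finset.mul_sum, Finset.sum_mul]
  rw [Finset.sum_comm]

/-- Maurey's empirical method: averages of `k` random vertices approximate a point of the `ℓ₁`
ball in mean square, at rate `1 / k`. -/
theorem sum_weight_mul_sq_l1VertexMean_sub_le {r M : ℝ} (hr : 0 ≤ r) (hM : 0 ≤ M)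
    {β : Fin d → ℝ} (hβ : β ∈ l1Ball d r) {x : Fin d → ℝ} (hx : ∀ j, |x j| ≤ M) {k : ℕ}
    (hk : 0 < k) :
    ∑ f : Fin k → Option (Fin d × Bool), (∏ s, l1Weight r β (f s)) *
        (∑ j, l1VertexMean r f j * x j - ∑ j, β j * x j) ^ 2 ≤ (r * M) ^ 2 / k := by
  have hk' : (0 : ℝ) < k := by exact_mod_cast hk
  set c := ∑ j, β j * x j
  set v : Option (Fin d × Bool) → ℝ := fun i => ∑ j, l1Vertex r i j * x j
  have hw := sum_l1Weight r β
  have hc : ∑ i, l1Weight r β i * v i = c := sum_l1Weight_mul hβ x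
  have hcenter : ∑ i, l1Weight r β i * (v i - c) = 0 := by
    simp only [mul_sub, Finset.sum_sub_distrib, ← Finset.sum_mul, hc, hw]
    ring
  have hdiff : ∀ f : Fin k → Option (Fin d × Bool),
      (∑ j, l1VertexMean r f j * x j - c) ^ 2 = (1 / (k : ℝ)) ^ 2 * (∑ s, (v (f s) - c)) ^ 2 := by
    intro f
    rw [sum_l1VertexMean_mul, ← mul_pow, Finset.sum_sub_distrib]
    simp only [Finset.sum_const, Finset.card_univ, Fintype.card_fin, nsmul_eq_mul]
    congr 1
    field_simp
    rfl
  -- The variance is at most the second moment, and every vertex has `|v i| ≤ r * M`.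
  have hvar : ∑ i, l1Weight r β i * (v i - c) ^ 2 ≤ (r * M) ^ 2 := by
    have hexp : ∑ i, l1Weight r β i * (v i - c) ^ 2
        = ∑ i, l1Weight r β i * v i ^ 2 - c ^ 2 := by
      have : ∀ i, l1Weight r β i * (v i - c) ^ 2
          = l1Weight r β i * v i ^ 2 - 2 * c * (l1Weight r β i * v i)
            + l1Weight r β i * c ^ 2 := fun i => by ring
      simp only [this, Finset.sum_add_distrib, Finset.sum_sub_distrib, ← Finset.mul_sum,
        ← Finset.sum_mul, hc, hw]
      ring
    have hle : ∑ i, l1Weight r β i * v i ^ 2 ≤ ∑ i, l1Weight r β i * (r * M) ^ 2 := by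
      refine Finset.sum_le_sum fun i _ => mul_le_mul_of_nonneg_left ?_ (l1Weight_nonneg hr hβ i)
      exact sq_le_sq' (abs_le.1 (abs_sum_l1Vertex_mul_le hr hM hx i)).1
        (abs_le.1 (abs_sum_l1Vertex_mul_le hr hM hx i)).2
    rw [← Finset.sum_mul, hw, one_mul] at hle
    rw [hexp]
    linarith [sq_nonneg c]
  have hrw : ∀ f : Fin k → Option (Fin d × Bool), (∏ s, l1Weight r β (f s)) *
      (∑ j, l1VertexMean r f j * x j - c) ^ 2
      = (1 / (k : ℝ)) ^ 2 * ((∏ s, l1Weight r β (f s)) * (∑ s, (v (f s) - c)) ^ 2) := by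
    intro f
    rw [hdiff]
    ring
  simp only [hrw, ← Finset.mul_sum]
  rw [sum_prod_weight_mul_sum_sq hw hcenter]
  calc (1 / (k : ℝ)) ^ 2 * (k * ∑ i, l1Weight r β i * (v i - c) ^ 2)
      = (∑ i, l1Weight r β i * (v i - c) ^ 2) / k := by field_simp
    _ ≤ (r * M) ^ 2 / k := by gcongr

end Vertices

/-! ### Regularity of the loss and transfer from vertex averages to the ball -/

section Loss

variable {l : ℝ → ℝ → ℝ} {ρ : ℝ → ℝ} {C : ℝ}

theorem continuous_link (hcond : BoundedUniformlyContinuous l ρ) (y : ℝ) :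
    Continuous fun t => l y (ρ t) := by
  refine Metric.continuous_iff.2 fun t ε hε => ?_
  obtain ⟨δ, hδ, h⟩ := hcond.2 ε hε
  exact ⟨δ, hδ, fun s hs => h y s t hs⟩

theorem continuous_loss (hcond : BoundedUniformlyContinuous l ρ) {d : ℕ} (z : Obs d) :
    Continuous fun β : Fin d → ℝ => l z.1 (linkPredictor ρ β z.2) :=
  (continuous_link hcond z.1).comp (by fun_prop)

theorem measurable_loss (hl_meas : ∀ t, Measurable fun y => l y (ρ t))
    (hcond : BoundedUniformlyContinuous l ρ) {d : ℕ} (β : Fin d → ℝ) :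
    Measurable fun z : Obs d => l z.1 (linkPredictor ρ β z.2) := by
  have h : Measurable (Function.uncurry fun t y => l y (ρ t)) :=
    measurable_uncurry_of_continuous_of_measurable (continuous_link hcond) hl_meas
  have hpair : Measurable fun z : Obs d => (∑ j, β j * z.2 j, z.1) := by fun_prop
  exact h.comp hpair

theorem integrable_loss (hl_meas : ∀ t, Measurable fun y => l y (ρ t))
    (hcond : BoundedUniformlyContinuous l ρ) {d : ℕ} (F : ProbabilityMeasure (Obs d))
    (β : Fin d → ℝ) :
    Integrable (fun z : Obs d => l z.1 (linkPredictor ρ β z.2)) (F : Measure (Obs d)) := by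
  obtain ⟨C, hC⟩ := hcond.1
  exact Integrable.of_bound (measurable_loss hl_meas hcond β).aestronglyMeasurable C
    (ae_of_all _ fun z => hC _ _)

theorem continuous_risk (hl_meas : ∀ t, Measurable fun y => l y (ρ t))
    (hcond : BoundedUniformlyContinuous l ρ) {d : ℕ} (F : ProbabilityMeasure (Obs d)) :
    Continuous (risk l (linkPredictor ρ) F) := by
  obtain ⟨C, hC⟩ := hcond.1
  exact continuous_of_dominated
    (fun β => (measurable_loss hl_meas hcond β).aestronglyMeasurable)
    (fun β => ae_of_all _ fun z => hC _ _) (integrable_const C)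
    (ae_of_all _ fun z => continuous_loss hcond z)

theorem continuous_empiricalRisk (hcond : BoundedUniformlyContinuous l ρ) {n d : ℕ}
    (z : Fin n → Obs d) : Continuous (empiricalRisk l (linkPredictor ρ) z) :=
  continuous_const.mul (continuous_finsetSum _ fun i _ => continuous_loss hcond (z i))

theorem isCompact_l1Ball (d : ℕ) (r : ℝ) : IsCompact (l1Ball d r) := by
  refine Metric.isCompact_of_isClosed_isBounded ?_ ?_
  · exact isClosed_le (by fun_prop) continuous_const
  · refine (Metric.isBounded_closedBall (x := (0 : Fin d → ℝ)) (r := |r|)).subset fun β hβ => ?_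
    rw [mem_closedBall_zero_iff, pi_norm_le_iff_of_nonneg (abs_nonneg r)]
    intro j
    exact (Finset.single_le_sum (f := fun j => |β j|) (fun j _ => abs_nonneg _)
      (Finset.mem_univ j)).trans (le_trans hβ (le_abs_self r))

theorem exists_isArgMin_l1Ball {d : ℕ} {r : ℝ} (hr : 0 ≤ r) {f : (Fin d → ℝ) → ℝ}
    (hf : Continuous f) : ∃ β, IsArgMin f (l1Ball d r) β := by
  have hne : (l1Ball d r).Nonempty := ⟨0, by simpa [l1Ball] using hr⟩
  obtain ⟨β, hβ, hmin⟩ := (isCompact_l1Ball d r).exists_isMinOn hne hf.continuousOn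
  exact ⟨β, hβ, fun β' hβ' => hmin hβ'⟩

/-- Either `|s - t| < δ` and the modulus of continuity applies, or `(s - t)² / δ² ≥ 1` and the
trivial bound `2 * C` is enough. The quadratic form lets a mean square estimate suffice without any
Lipschitz condition. -/
theorem abs_sub_le_add_mul_sq (hC : ∀ y t, |l y (ρ t)| ≤ C) {ε δ : ℝ} (hε : 0 ≤ ε)
    (hδ : 0 < δ) (h : ∀ y s t, |s - t| < δ → |l y (ρ s) - l y (ρ t)| < ε) (y s t : ℝ) :
    |l y (ρ s) - l y (ρ t)| ≤ ε + 2 * C / δ ^ 2 * (s - t) ^ 2 := by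
  have hC0 : 0 ≤ C := (abs_nonneg _).trans (hC y t)
  rcases lt_or_ge |s - t| δ with hst | hst
  · have : 0 ≤ 2 * C / δ ^ 2 * (s - t) ^ 2 := by positivity
    linarith [h y s t hst]
  · have hsq : δ ^ 2 ≤ (s - t) ^ 2 := by
      rw [← sq_abs (s - t)]
      gcongr
    have hle : |l y (ρ s) - l y (ρ t)| ≤ 2 * C := by
      linarith [abs_sub (l y (ρ s)) (l y (ρ t)), hC y s, hC y t]
    have : 2 * C ≤ 2 * C / δ ^ 2 * (s - t) ^ 2 := by
      rw [div_mul_eq_mul_div, le_div_iff₀ (by positivity)]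
      gcongr
    linarith

variable {d : ℕ} {r M ε δ : ℝ} {β : Fin d → ℝ} {k : ℕ}

theorem sum_prod_l1Weight (r : ℝ) (β : Fin d → ℝ) (k : ℕ) :
    ∑ f : Fin k → Option (Fin d × Bool), ∏ s, l1Weight r β (f s) = 1 := by
  rw [← Fintype.sum_pow, sum_l1Weight, one_pow]

/-- The bound is uniform over observations with bounded covariates and the weights do not depend on
`z`, so it can be averaged over `F` and over the sample alike. -/
theorem abs_sum_weight_mul_loss_sub_le (hC : ∀ y t, |l y (ρ t)| ≤ C) (hε : 0 ≤ ε)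
    (hδ : 0 < δ) (h : ∀ y s t, |s - t| < δ → |l y (ρ s) - l y (ρ t)| < ε)
    (hr : 0 ≤ r) (hM : 0 ≤ M) (hβ : β ∈ l1Ball d r) (hk : 0 < k) {z : Obs d}
    (hz : ∀ j, |z.2 j| ≤ M) :
    |∑ f : Fin k → Option (Fin d × Bool), (∏ s, l1Weight r β (f s)) *
        (l z.1 (linkPredictor ρ (l1VertexMean r f) z.2) - l z.1 (linkPredictor ρ β z.2))|
      ≤ ε + 2 * C / δ ^ 2 * ((r * M) ^ 2 / k) := by
  have hC0 : 0 ≤ C := (abs_nonneg _).trans (hC 0 0)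
  have hW : ∀ f : Fin k → Option (Fin d × Bool), 0 ≤ ∏ s, l1Weight r β (f s) :=
    fun f => Finset.prod_nonneg fun s _ => l1Weight_nonneg hr hβ _
  refine (Finset.abs_sum_le_sum_abs _ _).trans ?_
  calc _ ≤ ∑ f : Fin k → Option (Fin d × Bool), ((∏ s, l1Weight r β (f s)) * ε
          + 2 * C / δ ^ 2 * ((∏ s, l1Weight r β (f s)) *
            (∑ j, l1VertexMean r f j * z.2 j - ∑ j, β j * z.2 j) ^ 2)) := by
        refine Finset.sum_le_sum fun f _ => ?_
        rw [abs_mul, abs_of_nonneg (hW f)]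
        refine (mul_le_mul_of_nonneg_left (abs_sub_le_add_mul_sq hC hε hδ h _ _ _)
          (hW f)).trans_eq ?_
        ring
    _ ≤ ε + 2 * C / δ ^ 2 * ((r * M) ^ 2 / k) := by
        rw [Finset.sum_add_distrib, ← Finset.sum_mul, ← Finset.mul_sum, sum_prod_l1Weight, one_mul]
        have := sum_weight_mul_sq_l1VertexMean_sub_le hr hM hβ hz hk
        gcongr

theorem abs_sum_weight_mul_risk_sub_le (hl_meas : ∀ t, Measurable fun y => l y (ρ t))
    (hcond : BoundedUniformlyContinuous l ρ) (hC : ∀ y t, |l y (ρ t)| ≤ C) (hε : 0 ≤ ε)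
    (hδ : 0 < δ) (h : ∀ y s t, |s - t| < δ → |l y (ρ s) - l y (ρ t)| < ε)
    (hr : 0 ≤ r) (hM : 0 ≤ M) (hβ : β ∈ l1Ball d r) (hk : 0 < k)
    {F : ProbabilityMeasure (Obs d)} (hF : ∀ᵐ z ∂(F : Measure (Obs d)), ∀ j, |z.2 j| ≤ M) :
    |∑ f : Fin k → Option (Fin d × Bool), (∏ s, l1Weight r β (f s)) *
        (risk l (linkPredictor ρ) F (l1VertexMean r f) - risk l (linkPredictor ρ) F β)|
      ≤ ε + 2 * C / δ ^ 2 * ((r * M) ^ 2 / k) := by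
  have hint := integrable_loss hl_meas hcond F
  have heq : ∑ f : Fin k → Option (Fin d × Bool), (∏ s, l1Weight r β (f s)) *
      (risk l (linkPredictor ρ) F (l1VertexMean r f) - risk l (linkPredictor ρ) F β)
      = ∫ z, ∑ f : Fin k → Option (Fin d × Bool), (∏ s, l1Weight r β (f s)) *
        (l z.1 (linkPredictor ρ (l1VertexMean r f) z.2) - l z.1 (linkPredictor ρ β z.2))
          ∂(F : Measure (Obs d)) := by
    have hterm : ∀ f : Fin k → Option (Fin d × Bool), Integrable (fun z : Obs d =>
        (∏ s, l1Weight r β (f s)) * (l z.1 (linkPredictor ρ (l1VertexMean r f) z.2)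
          - l z.1 (linkPredictor ρ β z.2))) (F : Measure (Obs d)) :=
      fun f => ((hint _).sub (hint β)).const_mul _
    rw [integral_finsetSum _ fun f _ => hterm f]
    refine Finset.sum_congr rfl fun f _ => ?_
    rw [integral_const_mul, integral_sub (hint _) (hint _)]
    rfl
  rw [heq]
  have hbound := norm_integral_le_of_norm_le_const (μ := (F : Measure (Obs d))) (hF.mono fun z hz =>
    (Real.norm_eq_abs _).trans_le <| abs_sum_weight_mul_loss_sub_le hC hε hδ h hr hM hβ hk hz)
  simpa using hbound

theorem abs_sum_weight_mul_empiricalRisk_sub_le (hC : ∀ y t, |l y (ρ t)| ≤ C) (hε : 0 ≤ ε)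
    (hδ : 0 < δ) (h : ∀ y s t, |s - t| < δ → |l y (ρ s) - l y (ρ t)| < ε)
    (hr : 0 ≤ r) (hM : 0 ≤ M) (hβ : β ∈ l1Ball d r) (hk : 0 < k) {n : ℕ} (hn : 0 < n)
    {z : Fin n → Obs d} (hz : ∀ i j, |(z i).2 j| ≤ M) :
    |∑ f : Fin k → Option (Fin d × Bool), (∏ s, l1Weight r β (f s)) *
        (empiricalRisk l (linkPredictor ρ) z (l1VertexMean r f)
          - empiricalRisk l (linkPredictor ρ) z β)|
      ≤ ε + 2 * C / δ ^ 2 * ((r * M) ^ 2 / k) := by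
  have hn' : (0 : ℝ) < n := by exact_mod_cast hn
  have heq : ∑ f : Fin k → Option (Fin d × Bool), (∏ s, l1Weight r β (f s)) *
        (empiricalRisk l (linkPredictor ρ) z (l1VertexMean r f)
          - empiricalRisk l (linkPredictor ρ) z β)
      = (1 / (n : ℝ)) * ∑ i, ∑ f : Fin k → Option (Fin d × Bool), (∏ s, l1Weight r β (f s)) *
        (l (z i).1 (linkPredictor ρ (l1VertexMean r f) (z i).2)
          - l (z i).1 (linkPredictor ρ β (z i).2)) := by
    rw [Finset.sum_comm, Finset.mul_sum]
    refine Finset.sum_congr rfl fun f _ => ?_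
    rw [← Finset.mul_sum, Finset.sum_sub_distrib, empiricalRisk, empiricalRisk]
    ring
  rw [heq, abs_mul, abs_of_pos (by positivity), one_div, inv_mul_le_iff₀ hn']
  refine (Finset.abs_sum_le_sum_abs _ _).trans ?_
  refine (Finset.sum_le_sum fun i _ =>
    abs_sum_weight_mul_loss_sub_le hC hε hδ h hr hM hβ hk (hz i)).trans_eq ?_
  rw [Finset.sum_const, Finset.card_univ, Fintype.card_fin, nsmul_eq_mul]

/-- A deviation bound on the averages of `k` vertices extends to the whole `ℓ₁` ball. -/
theorem abs_empiricalRisk_sub_risk_le (hl_meas : ∀ t, Measurable fun y => l y (ρ t))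
    (hcond : BoundedUniformlyContinuous l ρ) (hC : ∀ y t, |l y (ρ t)| ≤ C) (hε : 0 ≤ ε)
    (hδ : 0 < δ) (h : ∀ y s t, |s - t| < δ → |l y (ρ s) - l y (ρ t)| < ε)
    (hr : 0 ≤ r) (hM : 0 ≤ M) (hβ : β ∈ l1Ball d r) (hk : 0 < k)
    {F : ProbabilityMeasure (Obs d)} (hF : ∀ᵐ z ∂(F : Measure (Obs d)), ∀ j, |z.2 j| ≤ M)
    {n : ℕ} (hn : 0 < n) {z : Fin n → Obs d} (hz : ∀ i j, |(z i).2 j| ≤ M) {t : ℝ}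
    (ht : ∀ f : Fin k → Option (Fin d × Bool),
      |empiricalRisk l (linkPredictor ρ) z (l1VertexMean r f)
        - risk l (linkPredictor ρ) F (l1VertexMean r f)| ≤ t) :
    |empiricalRisk l (linkPredictor ρ) z β - risk l (linkPredictor ρ) F β|
      ≤ t + 2 * (ε + 2 * C / δ ^ 2 * ((r * M) ^ 2 / k)) := by
  have h1 := abs_sum_weight_mul_risk_sub_le hl_meas hcond hC hε hδ h hr hM hβ hk hF
  have h2 := abs_sum_weight_mul_empiricalRisk_sub_le hC hε hδ h hr hM hβ hk hn hz
  have h3 : |∑ f : Fin k → Option (Fin d × Bool), (∏ s, l1Weight r β (f s)) *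
      (empiricalRisk l (linkPredictor ρ) z (l1VertexMean r f)
        - risk l (linkPredictor ρ) F (l1VertexMean r f))| ≤ t := by
    refine (Finset.abs_sum_le_sum_abs _ _).trans ?_
    have hW : ∀ f : Fin k → Option (Fin d × Bool), 0 ≤ ∏ s, l1Weight r β (f s) :=
      fun f => Finset.prod_nonneg fun s _ => l1Weight_nonneg hr hβ _
    refine (Finset.sum_le_sum fun f _ => ?_).trans_eq
      (?_ : ∑ f : Fin k → Option (Fin d × Bool), (∏ s, l1Weight r β (f s)) * t = t)
    · rw [abs_mul, abs_of_nonneg (hW f)]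
      exact mul_le_mul_of_nonneg_left (ht f) (hW f)
    · rw [← Finset.sum_mul, sum_prod_l1Weight, one_mul]
  -- As the weights sum to one, the deviation at `β` is the weighted mean of the deviations at the
  -- averages, up to the two approximation errors. No single average has to approximate `β` well for
  -- both risks.
  simp only [mul_sub, Finset.sum_sub_distrib, ← Finset.sum_mul, sum_prod_l1Weight, one_mul]
    at h1 h2 h3
  rw [abs_le] at h1 h2 h3 ⊢
  constructor <;> linarith [h1.1, h1.2, h2.1, h2.2, h3.1, h3.2]

end Loss

/-! ### Hoeffding's inequality at a fixed parameter -/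

section Deviation

theorem measure_abs_empiricalRisk_sub_risk_ge_le {l : ℝ → ℝ → ℝ} {ρ : ℝ → ℝ} {C : ℝ}
    (hl_meas : ∀ t, Measurable fun y => l y (ρ t))
    (hcond : BoundedUniformlyContinuous l ρ) (hC : ∀ y t, |l y (ρ t)| ≤ C) {d n : ℕ}
    (hn : 0 < n) (F : ProbabilityMeasure (Obs d)) (β : Fin d → ℝ) {t : ℝ} (ht : 0 ≤ t) :
    Measure.pi (fun _ : Fin n => (F : Measure (Obs d)))
        {z | t ≤ |empiricalRisk l (linkPredictor ρ) z β - risk l (linkPredictor ρ) F β|}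
      ≤ ENNReal.ofReal (2 * Real.exp (-(n * (t ^ 2 / (2 * C ^ 2))))) := by
  have hn' : (0 : ℝ) < n := by exact_mod_cast hn
  have hC0 : 0 ≤ C := (abs_nonneg _).trans (hC 0 0)
  set P := Measure.pi (fun _ : Fin n => (F : Measure (Obs d)))
  set X : Obs d → ℝ := fun z => l z.1 (linkPredictor ρ β z.2) - risk l (linkPredictor ρ) F β
    with hXdef
  have hX : Measurable X := (measurable_loss hl_meas hcond β).sub_const _
  have hsub : ProbabilityTheory.HasSubgaussianMGF X ((‖C - -C‖₊ / 2) ^ 2)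
      (F : Measure (Obs d)) :=
    ProbabilityTheory.hasSubgaussianMGF_of_mem_Icc (measurable_loss hl_meas hcond β).aemeasurable
      (ae_of_all _ fun z => abs_le.1 (hC _ _))
  have hsubP : ∀ i ∈ (Finset.univ : Finset (Fin n)), ProbabilityTheory.HasSubgaussianMGF
      (fun z : Fin n → Obs d => X (z i)) ((‖C - -C‖₊ / 2) ^ 2) P := by
    intro i _
    have heval := measurePreserving_eval (fun _ : Fin n => (F : Measure (Obs d))) i
    exact ProbabilityTheory.HasSubgaussianMGF.of_map (Y := Function.eval i)
      heval.measurable.aemeasurable (heval.map_eq.symm ▸ hsub)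
  have hindep : ProbabilityTheory.iIndepFun (fun i (z : Fin n → Obs d) => X (z i)) P :=
    ProbabilityTheory.iIndepFun_pi (X := fun _ => X) fun _ => hX.aemeasurable
  have hindep' : ProbabilityTheory.iIndepFun (fun i (z : Fin n → Obs d) => -X (z i)) P :=
    ProbabilityTheory.iIndepFun_pi (X := fun _ z => -X z) fun _ => hX.neg.aemeasurable
  have hnt : 0 ≤ n * t := by positivity
  have hup := ProbabilityTheory.HasSubgaussianMGF.measure_sum_ge_le_of_iIndepFun hindep hsubP hnt
  have hlow := ProbabilityTheory.HasSubgaussianMGF.measure_sum_ge_le_of_iIndepFun hindep'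
    (fun i hi => (hsubP i hi).neg) hnt
  have hexp : -(n * t) ^ 2 / (2 * ((∑ _i : Fin n, (‖C - -C‖₊ / 2) ^ 2 : NNReal) : ℝ))
      = -(n * (t ^ 2 / (2 * C ^ 2))) := by
    have : ((‖C - -C‖₊ / 2 : NNReal) : ℝ) = C := by
      push_cast
      rw [sub_neg_eq_add, ← two_mul, Real.norm_of_nonneg (by positivity)]
      ring
    simp only [Finset.sum_const, Finset.card_univ, Fintype.card_fin, nsmul_eq_mul, NNReal.coe_mul,
      NNReal.coe_pow, this, NNReal.coe_natCast]
    -- For `C = 0` both exponents are `0` by the convention for division by zero.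
    rcases eq_or_ne C 0 with rfl | hC'
    · simp
    · field_simp
  rw [hexp] at hup hlow
  have hset : {z : Fin n → Obs d |
        t ≤ |empiricalRisk l (linkPredictor ρ) z β - risk l (linkPredictor ρ) F β|}
      ⊆ {z | n * t ≤ ∑ i, X (z i)} ∪ {z | n * t ≤ ∑ i, -X (z i)} := by
    intro z hz
    have hsum : ∑ i, X (z i)
        = n * (empiricalRisk l (linkPredictor ρ) z β - risk l (linkPredictor ρ) F β) := by
      simp only [hXdef, Finset.sum_sub_distrib, empiricalRisk, Finset.sum_const, Finset.card_univ,
        Fintype.card_fin, nsmul_eq_mul]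
      field_simp
    rcases le_abs.1 (hz.out) with hz | hz
    · left
      rw [Set.mem_ofPred_eq, hsum]
      gcongr
    · right
      rw [Set.mem_ofPred_eq, Finset.sum_neg_distrib, hsum, ← mul_neg]
      gcongr
  refine (measure_mono hset).trans ((measure_union_le _ _).trans ?_)
  rw [two_mul, ENNReal.ofReal_add (Real.exp_nonneg _) (Real.exp_nonneg _)]
  rw [Measure.real, ← ENNReal.le_ofReal_iff_toReal_le (measure_ne_top _ _) (Real.exp_nonneg _)]
    at hup hlow
  exact add_le_add hup hlow

end Deviation

/-! ### Entropy against the exponential rate -/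

section Rates

theorem isBigO_log_two_mul_add_one {m : ℕ → ℕ} {α : ℝ}
    (hm : (fun n => (m n : ℝ)) =O[atTop] fun n : ℕ => (n : ℝ) ^ α) :
    (fun n => Real.log (2 * m n + 1)) =O[atTop] fun n : ℕ => Real.log n := by
  obtain ⟨K, hK, hbound⟩ := hm.exists_pos
  have hlog : Tendsto (fun n : ℕ => Real.log n) atTop atTop :=
    Real.tendsto_log_atTop.comp tendsto_natCast_atTop_atTop
  refine IsBigO.of_bound (1 + |α|) ?_
  filter_upwards [hbound.bound, eventually_ge_atTop 1,
    hlog.eventually_ge_atTop (Real.log (2 * K + 1))] with n hn hn1 hnK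
  have hn1' : (1 : ℝ) ≤ n := by exact_mod_cast hn1
  have hpow : (n : ℝ) ^ α ≤ (n : ℝ) ^ |α| := Real.rpow_le_rpow_of_exponent_le hn1' (le_abs_self α)
  have hone : (1 : ℝ) ≤ (n : ℝ) ^ |α| := Real.one_le_rpow hn1' (abs_nonneg α)
  rw [Real.norm_of_nonneg (by positivity), Real.norm_of_nonneg (by positivity)] at hn
  have hle : (2 * m n + 1 : ℝ) ≤ (2 * K + 1) * (n : ℝ) ^ |α| := by nlinarith
  have hm0 : (0 : ℝ) ≤ m n := by positivity
  rw [Real.norm_of_nonneg (Real.log_nonneg (by linarith)),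
    Real.norm_of_nonneg (Real.log_nonneg hn1')]
  calc Real.log (2 * m n + 1) ≤ Real.log ((2 * K + 1) * (n : ℝ) ^ |α|) :=
        Real.log_le_log (by positivity) hle
    _ = Real.log (2 * K + 1) + |α| * Real.log n := by
        rw [Real.log_mul (by positivity) (by positivity), Real.log_rpow (by positivity)]
    _ ≤ (1 + |α|) * Real.log n := by linarith

theorem isLittleO_sq_mul_log {m : ℕ → ℕ} {α : ℝ}
    (hm : (fun n => (m n : ℝ)) =O[atTop] fun n : ℕ => (n : ℝ) ^ α) {b : ℕ → ℝ}
    (hbo : b =o[atTop] fun n : ℕ => Real.sqrt ((n : ℝ) / Real.log n)) (κ : ℝ) :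
    (fun n => (κ * b n ^ 2 + 1) * Real.log (2 * m n + 1)) =o[atTop] fun n : ℕ => (n : ℝ) := by
  have hL := isBigO_log_two_mul_add_one hm
  have hlog : (fun n : ℕ => Real.log n) =o[atTop] fun n : ℕ => (n : ℝ) :=
    Real.isLittleO_log_id_atTop.comp_tendsto tendsto_natCast_atTop_atTop
  have hsq : (fun n => b n ^ 2 * Real.log (2 * m n + 1)) =o[atTop] fun n : ℕ => (n : ℝ) := by
    refine ((hbo.pow (n := 2) (by norm_num)).mul_isBigO hL).congr' EventuallyEq.rfl ?_
    filter_upwards [eventually_ge_atTop 2] with n hn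
    have hn' : (1 : ℝ) < n := by exact_mod_cast hn
    have hpos : 0 < Real.log n := Real.log_pos hn'
    rw [Real.sq_sqrt (by positivity)]
    field_simp
  refine ((hsq.const_mul_left κ).add (hL.trans_isLittleO hlog)).congr_left fun n => ?_
  ring

theorem tendsto_pow_mul_exp_neg {m : ℕ → ℕ} {α : ℝ}
    (hm : (fun n => (m n : ℝ)) =O[atTop] fun n : ℕ => (n : ℝ) ^ α) {b : ℕ → ℝ}
    (hbo : b =o[atTop] fun n : ℕ => Real.sqrt ((n : ℝ) / Real.log n)) {κ : ℝ} (hκ : 0 ≤ κ)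
    {c : ℝ} (hc : 0 < c) :
    Tendsto (fun n : ℕ => (2 * m n + 1 : ℝ) ^ (⌊κ * b n ^ 2⌋₊ + 1) * (2 * Real.exp (-(n * c))))
      atTop (𝓝 0) := by
  have hlim : Tendsto (fun n : ℕ => 2 * Real.exp (-(n * (c / 2)))) atTop (𝓝 0) := by
    rw [← mul_zero (2 : ℝ)]
    exact (Real.tendsto_exp_neg_atTop_nhds_zero.comp
      (tendsto_natCast_atTop_atTop.atTop_mul_const (half_pos hc))).const_mul 2
  refine tendsto_of_tendsto_of_tendsto_of_le_of_le' tendsto_const_nhds hlim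
    (Eventually.of_forall fun n => by positivity) ?_
  -- Half of the exponent `n * c` absorbs the entropy; the other half still tends to infinity.
  filter_upwards [(isLittleO_sq_mul_log hm hbo κ).bound (half_pos hc)] with n hn
  have hm0 : (0 : ℝ) ≤ m n := by positivity
  have hL : 0 ≤ Real.log (2 * m n + 1) := Real.log_nonneg (by linarith)
  rw [Real.norm_of_nonneg (by positivity), Real.norm_of_nonneg (by positivity)] at hn
  have hk : ((⌊κ * b n ^ 2⌋₊ + 1 : ℕ) : ℝ) * Real.log (2 * m n + 1) ≤ c / 2 * n := by
    refine (mul_le_mul_of_nonneg_right ?_ hL).trans hn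
    push_cast
    linarith [Nat.floor_le (show 0 ≤ κ * b n ^ 2 by positivity)]
  have hpow : (2 * m n + 1 : ℝ) ^ (⌊κ * b n ^ 2⌋₊ + 1)
      = Real.exp (((⌊κ * b n ^ 2⌋₊ + 1 : ℕ) : ℝ) * Real.log (2 * m n + 1)) := by
    rw [Real.exp_nat_mul, Real.exp_log (by positivity)]
  rw [hpow, mul_left_comm, ← Real.exp_add]
  gcongr
  linarith

end Rates

end Persistence

/-! ### Persistence of the empirical risk minimiser -/

theorem corollary2
    -- the triangular array: dimensions growing at most polynomially, classes of distributions
    (m : ℕ → ℕ) (α : ℝ)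
    (hm : (fun n => (m n : ℝ)) =O[atTop] fun n : ℕ => (n : ℝ) ^ α)
    (𝓕 : ∀ n, Set (ProbabilityMeasure (Persistence.Obs (m n))))
    (hX : Persistence.BoundedCovariates m 𝓕)
    -- the nonnegative loss and the link function
    (l : ℝ → ℝ → ℝ) (ρ : ℝ → ℝ)
    (hl : ∀ y p, 0 ≤ l y p)
    (hl_meas : ∀ t, Measurable fun y => l y (ρ t))
    (hcond : Persistence.BoundedUniformlyContinuous l ρ)
    -- the radii of the balls
    (b : ℕ → ℝ) (hb : ∀ n, 0 ≤ b n)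
    (hbo : b =o[atTop] fun n : ℕ => Real.sqrt ((n : ℝ) / Real.log n)) :
    -- the constrained empirical risk minimiser exists for every sample
    (∀ n (z : Fin n → Persistence.Obs (m n)), ∃ β,
      Persistence.IsArgMin (Persistence.empiricalRisk l (Persistence.linkPredictor ρ) z)
        (Persistence.l1Ball (m n) (b n)) β) ∧
    -- and every choice of it is persistent
    ∀ βhat : ∀ n, (Fin n → Persistence.Obs (m n)) → (Fin (m n) → ℝ),
      (∀ n z, Persistence.IsArgMin
        (Persistence.empiricalRisk l (Persistence.linkPredictor ρ) z)
        (Persistence.l1Ball (m n) (b n)) (βhat n z)) →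
      Persistence.IsPersistent m 𝓕 (fun n => Persistence.l1Ball (m n) (b n)) l
        (fun _ => Persistence.linkPredictor ρ) βhat := by

  refine ⟨fun n z => Persistence.exists_isArgMin_l1Ball (hb n)
    (Persistence.continuous_empiricalRisk hcond z), fun βhat hβhat => ?_⟩
  choose βstar hβstar using fun n (F : ProbabilityMeasure (Persistence.Obs (m n))) =>
    Persistence.exists_isArgMin_l1Ball (hb n) (Persistence.continuous_risk hl_meas hcond F)
  refine ⟨βstar, fun n F _ => hβstar n F, fun ε hε => ?_⟩
  obtain ⟨C₀, hC₀⟩ := hcond.1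
  obtain ⟨M₀, hM₀⟩ := hX
  -- Deviation, modulus and Maurey error each get `ε / 10`. The deviation on the ball is then at
  -- most `ε/10 + 2 (ε/10 + ε/10) = ε/2`, and it is paid twice.
  obtain ⟨δ, hδ, hmod⟩ := hcond.2 (ε / 10) (by positivity)
  set C := |C₀| + 1
  set M := |M₀|
  have hCpos : 0 < C := by positivity
  have hM : 0 ≤ M := abs_nonneg _
  have hC : ∀ y t, |l y (ρ t)| ≤ C := fun y t => by
    linarith [hC₀ y t, le_abs_self C₀]
  set κ := 2 * C / δ ^ 2 * M ^ 2 / (ε / 10)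
  have hκ : 0 ≤ κ := by positivity
  have hc : 0 < (ε / 10) ^ 2 / (2 * C ^ 2) := by positivity
  have hlim := ENNReal.tendsto_ofReal (Persistence.tendsto_pow_mul_exp_neg hm hbo hκ hc)
  rw [ENNReal.ofReal_zero] at hlim
  refine tendsto_of_tendsto_of_tendsto_of_le_of_le' tendsto_const_nhds hlim
    (Eventually.of_forall fun n => zero_le) ?_
  filter_upwards [eventually_gt_atTop 0] with n hn
  refine iSup₂_le fun F hF => ?_
  -- `κ` is chosen so that `k ≥ κ b²` makes the Maurey error at most `ε / 10`; the `+ 1` keeps `k`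
  -- positive when `b n = 0`.
  set k := ⌊κ * b n ^ 2⌋₊ + 1
  have hFM : ∀ᵐ z ∂(F : Measure (Persistence.Obs (m n))), ∀ j, |z.2 j| ≤ M :=
    (hM₀ n F hF).mono fun z hz j => (hz j).trans (le_abs_self M₀)
  have happrox : 2 * C / δ ^ 2 * ((b n * M) ^ 2 / k) ≤ ε / 10 := by
    have hk : κ * b n ^ 2 ≤ k := by
      simpa [k] using (Nat.lt_floor_add_one (κ * b n ^ 2)).le
    rw [← mul_div_assoc, div_le_iff₀ (by positivity)]
    calc 2 * C / δ ^ 2 * (b n * M) ^ 2 = ε / 10 * (κ * b n ^ 2) := by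
          simp only [κ]
          field_simp
      _ ≤ ε / 10 * k := by gcongr
  set P := Measure.pi (fun _ : Fin n => (F : Measure (Persistence.Obs (m n))))
  have hPM : ∀ᵐ z ∂P, ∀ i j, |(z i).2 j| ≤ M :=
    ae_all_iff.2 fun i =>
    (Measure.tendsto_eval_ae_ae (μ := fun _ : Fin n => (F : Measure (Persistence.Obs (m n))))
      (i := i)).eventually hFM
  calc P {z | ε < Persistence.risk l (Persistence.linkPredictor ρ) F (βhat n z)
          - Persistence.risk l (Persistence.linkPredictor ρ) F (βstar n F)}
      ≤ P (⋃ f : Fin k → Option (Fin (m n) × Bool), {z | ε / 10 ≤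
          |Persistence.empiricalRisk l (Persistence.linkPredictor ρ) z
              (Persistence.l1VertexMean (b n) f)
            - Persistence.risk l (Persistence.linkPredictor ρ) F
              (Persistence.l1VertexMean (b n) f)|}) := by
        -- The inclusion of events holds only for samples with bounded covariates, hence almost
        -- surely. The outer measure is monotone, so `βhat` need not be measurable.
        refine measure_mono_ae (hPM.mono fun z hz hexcess => ?_)
        by_contra hnot
        have hnot' := fun f hf => hnot (Set.mem_iUnion.2 ⟨f, hf⟩)
        have hdev : ∀ β ∈ Persistence.l1Ball (m n) (b n), _ := fun β hβ =>
          Persistence.abs_empiricalRisk_sub_risk_le hl_meas hcond hC (by positivity) hδ hmod (hb n)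
            hM hβ (Nat.succ_pos _) hFM hn hz fun f => (not_le.1 (hnot' f)).le
        have hhat := abs_le.1 (hdev _ (hβhat n z).1)
        have hstar := abs_le.1 (hdev _ (hβstar n F).1)
        have hmin := (hβhat n z).2 _ (hβstar n F).1
        have hexcess' : ε < Persistence.risk l (Persistence.linkPredictor ρ) F (βhat n z)
          - Persistence.risk l (Persistence.linkPredictor ρ) F (βstar n F) := hexcess
        linarith [hhat.1, hstar.2]
    _ ≤ ∑ _f : Fin k → Option (Fin (m n) × Bool),
          ENNReal.ofReal (2 * Real.exp (-(n * ((ε / 10) ^ 2 / (2 * C ^ 2))))) :=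
        (measure_iUnion_fintype_le _ _).trans (Finset.sum_le_sum fun f _ =>
          Persistence.measure_abs_empiricalRisk_sub_risk_ge_le hl_meas hcond hC hn F _
            (by positivity))
    _ = ENNReal.ofReal ((2 * m n + 1 : ℝ) ^ k
          * (2 * Real.exp (-(n * ((ε / 10) ^ 2 / (2 * C ^ 2)))))) := by
        rw [ENNReal.ofReal_mul (p := (2 * m n + 1 : ℝ) ^ k) (by positivity),
          ENNReal.ofReal_pow (by positivity)]
        have hcard : ENNReal.ofReal (2 * m n + 1 : ℝ) = ((m n * 2 + 1 : ℕ) : ENNReal) := by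
          rw [← ENNReal.ofReal_natCast]
          push_cast
          ring_nf
        rw [Finset.sum_const, Finset.card_univ, hcard]
        simp
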